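/- Let $D\subset\mathbb C^n$ be a domain (a non-empty connected open set) that is $C^2$-smooth, i.e. every boundary point of $D$ has an open neighborhood $U$ with a real-valued function $r\in C^2(U)$ such that $dr\ne0$ on $U$ and $D\cap U=\{z\in U: r(z)<0\}$. Suppose that for every boundary point $a\in\partial D$ there are an open neighborhood $U_a$ of $a$ and a plurisubharmonic function $u_a:D\cap U_a\to[-\infty,\infty)$ such that $$\limsup_{D\cap U_a\ni z\to a}u_a(z)=\infty.$$ Then $D$ is pseudoconvex, i.e. the function $z\mapsto-\log\operatorname{dist}(z,\partial D)$ (Euclidean distance; constantly $-\infty$ if $\partial D=\varnothing$) is plurisubharmonic on $D$. -/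

import Mathlib

open Set Filter Topology Metric

/-- A function `v`, with values in `[-∞, ∞)` on the open set `G ⊆ ℂ`, is subharmonic on `G`: it is
upper semicontinuous and, for every closed disc contained in `G`, it lies below every function
that is continuous on the closed disc, harmonic on the open disc and dominates `v` on the
bounding circle. (The constant `-∞` is allowed; values of `v` outside `G` are irrelevant.) -/
def SubharmonicOn (v : ℂ → EReal) (G : Set ℂ) : Prop :=
  UpperSemicontinuousOn v G ∧
  (∀ ζ ∈ G, v ζ ≠ ⊤) ∧
  ∀ (c : ℂ) (ρ : ℝ) (h : ℂ → ℝ), 0 < ρ → closedBall c ρ ⊆ G →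
    ContinuousOn h (closedBall c ρ) →
    InnerProductSpace.HarmonicOnNhd h (ball c ρ) →
    (∀ ζ ∈ sphere c ρ, v ζ ≤ (h ζ : EReal)) →
    ∀ ζ ∈ ball c ρ, v ζ ≤ (h ζ : EReal)

/-- A function `u`, with values in `[-∞, ∞)` on the open set `Ω ⊆ ℂⁿ`, is plurisubharmonic on
`Ω`: it is upper semicontinuous on `Ω` and its restriction to every complex line is subharmonic
where it is defined. -/
def PlurisubharmonicOn {n : ℕ} (u : EuclideanSpace ℂ (Fin n) → EReal)
    (Ω : Set (EuclideanSpace ℂ (Fin n))) : Prop :=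
  UpperSemicontinuousOn u Ω ∧
  (∀ z ∈ Ω, u z ≠ ⊤) ∧
  ∀ z w : EuclideanSpace ℂ (Fin n),
    SubharmonicOn (fun ζ : ℂ => u (z + ζ • w)) {ζ : ℂ | z + ζ • w ∈ Ω}

/-- An open set `D ⊆ ℂⁿ` is pseudoconvex: `z ↦ -log dist(z, ∂D)` is plurisubharmonic on `D`.
For `∂D = ∅` the distance is `∞` and the function is the constant `-∞`. -/
noncomputable def IsPseudoconvex {n : ℕ} (D : Set (EuclideanSpace ℂ (Fin n))) : Prop :=
  PlurisubharmonicOn (fun z => -ENNReal.log (infEDist z (frontier D))) D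

/-- The open set `D ⊆ ℂⁿ` is `C²`-smooth: near every boundary point it has a (real) `C²` defining
function with nowhere vanishing differential. -/
def IsC2Smooth {n : ℕ} (D : Set (EuclideanSpace ℂ (Fin n))) : Prop :=
  ∀ a ∈ frontier D, ∃ (U : Set (EuclideanSpace ℂ (Fin n)))
    (r : EuclideanSpace ℂ (Fin n) → ℝ),
    IsOpen U ∧ a ∈ U ∧ ContDiffOn ℝ 2 r U ∧ (∀ z ∈ U, fderiv ℝ r z ≠ 0) ∧
    D ∩ U = {z ∈ U | r z < 0}

/-! Argue by contradiction. If `-log dist` is not plurisubharmonic, it violates the maximum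
principle on a disc in some complex line, so at some `p` on that line it is touched from above by a
strictly superharmonic quadratic polynomial (`exists_touch_of_not_le_harmonic`). Exponentiated, this
says that the distance exceeds the modulus of a holomorphic function by a quadratic margin. Let `b`
be a boundary point nearest to `p`. Translating `p` along the line and multiplying `b - p` by the
2-jet of that function gives a holomorphic disc through `b` that otherwise stays in `D`, again with
quadratic margin. The Levi form at `b` is therefore negative in a complex tangent direction
(`exists_levi_neg_of_touch`).

Near such a `b` every plurisubharmonic `u` is bounded above, against the hypothesis
(`PlurisubharmonicOn.exists_eventually_le_of_levi_neg`). For `z₀` in `D` near `b`, put `s = -r z₀`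
and compare `u` with `exp (l (r + κ‖z - z₀‖² + s))`. Along a direction tangent to the level set of
the exponent, the exponential has no second-order term in `l²`, so for every `l > 0` its Levi form
is negative there and `u - exp` has no interior maximum. A large `l` controls the part of the
boundary near `∂D`; the spherical part has a bound independent of `z₀`. -/

/-! ### Second-order expansions and maxima along parabolas -/

open Asymptotics in
/-- Second order Taylor expansion with Peano remainder. -/
theorem ContDiffAt.taylor_two_isLittleO {E : Type*} [NormedAddCommGroup E] [NormedSpace ℝ E]
    {f : E → ℝ} {p : E} (hf : ContDiffAt ℝ 2 f p) :
    (fun y => f (p + y) - f p - fderiv ℝ f p y - 1 / 2 * fderiv ℝ (fderiv ℝ f) p y y)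
      =o[𝓝 0] fun y => ‖y‖ ^ 2 := by
  set L := fderiv ℝ f p
  set B := fderiv ℝ (fderiv ℝ f) p
  have hsymm : ∀ x y, B x y = B y x := by
    have h := hf.isSymmSndFDerivAt (by simp)
    exact fun x y => h x y
  have hB : HasFDerivAt (fderiv ℝ f) B p :=
    ((hf.fderiv_right (m := 1) (by norm_num)).differentiableAt (by norm_num)).hasFDerivAt
  have hdiff : ∀ᶠ y in 𝓝 (0 : E), DifferentiableAt ℝ f (p + y) := by
    have h1 : ∀ᶠ x in 𝓝 p, DifferentiableAt ℝ f x :=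
      (hf.eventually (by simp)).mono fun x hx => hx.differentiableAt (by norm_num)
    have h2 : Tendsto (fun y : E => p + y) (𝓝 0) (𝓝 p) := by
      have : Continuous fun y : E => p + y := by fun_prop
      simpa using this.tendsto 0
    exact h2.eventually h1
  rw [isLittleO_iff]
  intro ε hε
  have hsmall := (isLittleO_iff.1 (hasFDerivAt_iff_isLittleO_nhds_zero.1 hB)) hε
  obtain ⟨δ, hδ, hball⟩ := Metric.eventually_nhds_iff_ball.1 (hdiff.and hsmall)
  filter_upwards [Metric.ball_mem_nhds (0 : E) hδ] with y hy
  -- By symmetry of `B`, the remainder `g` has derivative `fderiv ℝ f (p + x) - L - B x = o(‖x‖)`;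
  -- the mean value inequality on the ball of radius `‖y‖` gains the second factor `‖y‖`.
  set g : E → ℝ := fun y => f (p + y) - f p - L y - 1 / 2 * B y y
  have hg : ∀ x ∈ closedBall (0 : E) ‖y‖,
      HasFDerivWithinAt g (fderiv ℝ f (p + x) - L - B x) (closedBall (0 : E) ‖y‖) x := by
    intro x hx
    have hxδ : x ∈ ball (0 : E) δ := by
      rw [mem_ball_zero_iff] at hy ⊢
      exact (mem_closedBall_zero_iff.1 hx).trans_lt hy
    have h1 : HasFDerivAt (fun y => f (p + y)) (fderiv ℝ f (p + x)) x := by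
      have := (hball x hxδ).1.hasFDerivAt.comp x ((hasFDerivAt_id x).const_add p)
      exact this
    have h2 : HasFDerivAt (fun y => B y y) (B x + B.flip x) x := by
      have := B.hasFDerivAt_of_bilinear (hasFDerivAt_id x) (hasFDerivAt_id x)
      refine this.congr_fderiv ?_
      ext z
      simp [hsymm]
    have h3 := ((h1.sub_const (f p)).sub L.hasFDerivAt).sub (h2.const_mul (1 / 2))
    refine (h3.congr_fderiv ?_).hasFDerivWithinAt
    ext z
    simp [hsymm z x]
    ring
  have hbd : ∀ x ∈ closedBall (0 : E) ‖y‖, ‖fderiv ℝ f (p + x) - L - B x‖ ≤ ε * ‖y‖ := by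
    intro x hx
    have hx' := mem_closedBall_zero_iff.1 hx
    have hxδ : x ∈ ball (0 : E) δ := by
      rw [mem_ball_zero_iff] at hy ⊢
      exact hx'.trans_lt hy
    exact (hball x hxδ).2.trans (by gcongr)
  have := (convex_closedBall (0 : E) ‖y‖).norm_image_sub_le_of_norm_hasFDerivWithin_le hg hbd
    (mem_closedBall_self (norm_nonneg y)) (mem_closedBall_zero_iff.2 le_rfl)
  have hg0 : g 0 = 0 := by simp [g]
  rw [hg0, sub_zero, sub_zero] at this
  calc ‖g y‖ ≤ ε * ‖y‖ * ‖y‖ := this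
    _ = ε * ‖‖y‖ ^ 2‖ := by simp; ring

theorem complex_smul_eq_re_smul_add_im_smul {E : Type*} [NormedAddCommGroup E] [NormedSpace ℂ E]
    [NormedSpace ℝ E] [IsScalarTower ℝ ℂ E] (ζ : ℂ) (Y : E) :
    ζ • Y = ζ.re • Y + ζ.im • (Complex.I • Y) := by
  conv_lhs => rw [← Complex.re_add_im ζ]
  rw [add_smul, mul_smul]
  congr 1
  · rw [← algebraMap_smul ℂ ζ.re Y]; rfl
  · rw [← algebraMap_smul ℂ ζ.im (Complex.I • Y)]; rfl

/-- A real quadratic form restricted to a complex line is the sum of the real part of a complex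
square and a multiple of the modulus squared. -/
theorem exists_quadratic_eq_re_add_normSq {E : Type*} [NormedAddCommGroup E] [NormedSpace ℂ E]
    [NormedSpace ℝ E] [IsScalarTower ℝ ℂ E] (B : E →L[ℝ] E →L[ℝ] ℝ) (Y : E) :
    ∃ β : ℂ, ∀ ζ : ℂ, 1 / 2 * B (ζ • Y) (ζ • Y) = (β * ζ ^ 2).re +
      (B Y Y + B (Complex.I • Y) (Complex.I • Y)) / 4 * ‖ζ‖ ^ 2 := by
  refine ⟨⟨(B Y Y - B (Complex.I • Y) (Complex.I • Y)) / 4,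
    -(B Y (Complex.I • Y) + B (Complex.I • Y) Y) / 4⟩, fun ζ => ?_⟩
  rw [complex_smul_eq_re_smul_add_im_smul, Complex.sq_norm, Complex.normSq_apply]
  simp [pow_two]
  ring

open Asymptotics in
/-- First and second order conditions for a function of one variable with a one-sided bound. -/
theorem linear_eq_zero_of_eventually_nonpos {g : ℝ → ℝ} {α β : ℝ}
    (hg : (fun t => g t - (α * t + β * t ^ 2)) =o[𝓝 0] fun t => t ^ 2)
    (hle : ∀ᶠ t in 𝓝 (0 : ℝ), g t ≤ 0) : α = 0 ∧ β ≤ 0 := by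
  have key : ∀ ε > 0, ∀ᶠ t in 𝓝 (0 : ℝ), α * t + β * t ^ 2 ≤ ε * t ^ 2 := by
    intro ε hε
    filter_upwards [isLittleO_iff.1 hg hε, hle] with t h1 h2
    rw [Real.norm_eq_abs, Real.norm_eq_abs, abs_of_nonneg (sq_nonneg t)] at h1
    linarith [(abs_le.1 h1).1]
  have hα : α = 0 := by
    obtain ⟨δ, hδ, h⟩ := Metric.eventually_nhds_iff_ball.1 (key 1 one_pos)
    have hlim : ∀ s : ℝ, Tendsto (fun t : ℝ => s * α + (β - 1) * t) (𝓝[>] 0) (𝓝 (s * α)) := by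
      intro s
      have : Continuous fun t : ℝ => s * α + (β - 1) * t := by fun_prop
      simpa using (this.tendsto 0).mono_left nhdsWithin_le_nhds
    have hs : ∀ s : ℝ, |s| = 1 → s * α ≤ 0 := by
      intro s hs
      refine le_of_tendsto (hlim s) ?_
      filter_upwards [Ioo_mem_nhdsGT hδ] with t ht
      have := h (s * t) (by
        rw [mem_ball_zero_iff, norm_mul, Real.norm_eq_abs, hs, one_mul, Real.norm_eq_abs,
          abs_of_pos ht.1]
        exact ht.2)
      have hs2 : s ^ 2 = 1 := by rw [← sq_abs, hs]; norm_num
      rw [mul_pow, hs2] at this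
      have ht := ht.1
      by_contra! hc
      nlinarith
    have h1 := hs 1 (by simp)
    have h2 := hs (-1) (by simp)
    linarith
  refine ⟨hα, le_of_forall_pos_le_add fun ε hε => ?_⟩
  obtain ⟨δ, hδ, h⟩ := Metric.eventually_nhds_iff_ball.1 (key ε hε)
  have := h (δ / 2) (by
    rw [mem_ball_zero_iff, Real.norm_eq_abs, abs_of_pos (by positivity)]; linarith)
  rw [hα, zero_mul, zero_add] at this
  rw [zero_add]
  exact le_of_mul_le_mul_right this (by positivity)

open Asymptotics in
/-- First and second order conditions at a point where a `C²` function restricted to a parabola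
has a local maximum. -/
theorem ContDiffAt.parabola_conditions {E : Type*} [NormedAddCommGroup E] [NormedSpace ℝ E]
    {f : E → ℝ} {p : E} (hf : ContDiffAt ℝ 2 f p) {X W : E}
    (hle : ∀ᶠ t : ℝ in 𝓝 0, f (p + (t • X + t ^ 2 • W)) ≤ f p) :
    fderiv ℝ f p X = 0 ∧ fderiv ℝ f p W + 1 / 2 * fderiv ℝ (fderiv ℝ f) p X X ≤ 0 := by
  have hT := hf.taylor_two_isLittleO
  set L := fderiv ℝ f p
  set B := fderiv ℝ (fderiv ℝ f) p
  set d : ℝ → E := fun t => t • X + t ^ 2 • W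
  have hd : Continuous d := by fun_prop
  have hd0 : Tendsto d (𝓝 0) (𝓝 0) := by simpa [d] using hd.tendsto 0
  have hdO : (fun t => ‖d t‖ ^ 2) =O[𝓝 0] fun t : ℝ => t ^ 2 := by
    have h1 : (fun t : ℝ => X + t • W) =O[𝓝 0] fun _ => (1 : ℝ) := by
      have : Continuous fun t : ℝ => X + t • W := by fun_prop
      exact (this.tendsto 0).isBigO_one ℝ
    have h2 : d =O[𝓝 0] fun t : ℝ => t := by
      have := (isBigO_refl (fun t : ℝ => t) (𝓝 0)).smul h1
      refine (this.congr_left fun t => ?_).congr_right fun t => ?_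
      · simp [d, smul_add, smul_smul, pow_two]
      · simp
    exact h2.norm_left.pow 2
  refine linear_eq_zero_of_eventually_nonpos (g := fun t => f (p + d t) - f p) ?_ ?_
  · have h1 := (hT.comp_tendsto hd0).trans_isBigO hdO
    have h2 : (fun t : ℝ => t ^ 3 * (1 / 2 * (B X W + B W X)) + t ^ 4 * (1 / 2 * B W W))
        =o[𝓝 0] fun t : ℝ => t ^ 2 := by
      have h3 : (fun t : ℝ => t ^ 3) =o[𝓝 0] fun t : ℝ => t ^ 2 :=
        isLittleO_pow_pow (by norm_num)
      have h4 : (fun t : ℝ => t ^ 4) =o[𝓝 0] fun t : ℝ => t ^ 2 :=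
        isLittleO_pow_pow (by norm_num)
      have h5 := h3.const_mul_left (1 / 2 * (B X W + B W X))
      have h6 := h4.const_mul_left (1 / 2 * B W W)
      exact (h5.add h6).congr_left fun t => by ring
    refine (h1.add h2).congr_left fun t => ?_
    simp [d]
    ring
  · filter_upwards [hle] with t ht
    simpa [d] using ht

/-! ### Touching from above in one complex variable -/

/-- A subharmonic function cannot be touched from above by a strictly superharmonic quadratic
polynomial. -/
theorem SubharmonicOn.not_touch {v : ℂ → EReal} {G : Set ℂ} (hv : SubharmonicOn v G)
    (hG : G ∈ 𝓝 0) {α c : ℝ} (A B : ℂ) (hc : 0 < c) (h0 : v 0 = α)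
    (hle : ∀ᶠ ζ in 𝓝 (0 : ℂ), v ζ ≤ ((α + (A * ζ + B * ζ ^ 2).re - c * ‖ζ‖ ^ 2 : ℝ) : EReal)) :
    False := by
  obtain ⟨δ, hδ, h⟩ := Metric.eventually_nhds_iff_ball.1 (hle.and (eventually_mem_set.2 hG))
  set ρ := δ / 2
  have hρ : 0 < ρ := by positivity
  have hsub : closedBall (0 : ℂ) ρ ⊆ ball 0 δ := closedBall_subset_ball (by simp [ρ]; linarith)
  -- `H` is harmonic, equals the touching polynomial on the circle of radius `ρ`, and is `c * ρ ^ 2`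
  -- below `v` at the centre.
  set H : ℂ → ℝ := fun ζ => (α - c * ρ ^ 2 + A * ζ + B * ζ ^ 2 : ℂ).re
  have hH : ∀ ζ, H ζ = α + (A * ζ + B * ζ ^ 2).re - c * ρ ^ 2 := by
    intro ζ
    simp only [H, Complex.add_re, Complex.sub_re, Complex.ofReal_re]
    rw [← Complex.ofReal_pow, ← Complex.ofReal_mul, Complex.ofReal_re]
    ring
  have := hv.2.2 0 ρ H hρ (fun ζ hζ => (h ζ (hsub hζ)).2) (by fun_prop)
    (fun ζ _ => AnalyticAt.harmonicAt_re (by fun_prop))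
    (fun ζ hζ => by
      have h1 := (h ζ (hsub (sphere_subset_closedBall hζ))).1
      rw [mem_sphere_zero_iff_norm] at hζ
      rwa [hζ, ← hH] at h1) 0 (mem_ball_self hρ)
  rw [h0, EReal.coe_le_coe_iff, hH] at this
  simp at this
  have : 0 < c * ρ ^ 2 := by positivity
  linarith

open Asymptotics in
/-- If a continuous function violates the maximum principle with respect to a harmonic function,
then it is touched from above by a strictly superharmonic quadratic polynomial. -/
theorem exists_touch_of_not_le_harmonic {v h : ℂ → ℝ} {c : ℂ} {ρ : ℝ}
    (hv : ContinuousOn v (closedBall c ρ)) (hh : ContinuousOn h (closedBall c ρ))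
    (hharm : InnerProductSpace.HarmonicOnNhd h (ball c ρ))
    (hle : ∀ ζ ∈ sphere c ρ, v ζ ≤ h ζ) {ζ₁ : ℂ} (hζ₁ : ζ₁ ∈ ball c ρ) (hlt : h ζ₁ < v ζ₁) :
    ∃ ζ₀ ∈ ball c ρ, ∃ (A B : ℂ) (κ : ℝ), 0 < κ ∧
      ∀ᶠ τ in 𝓝 (0 : ℂ), v (ζ₀ + τ) ≤ v ζ₀ + (A * τ + B * τ ^ 2).re - κ * ‖τ‖ ^ 2 := by
  have hρ : 0 < ρ := pos_of_mem_ball hζ₁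
  -- With this `ε` the added term is half the gap on the circle, so `g` is smaller there than at
  -- `ζ₁` and its maximum is interior.
  set ε := (v ζ₁ - h ζ₁) / (2 * ρ ^ 2)
  have hε : 0 < ε := by have := sub_pos.2 hlt; positivity
  have hερ : ε * ρ ^ 2 = (v ζ₁ - h ζ₁) / 2 := by simp only [ε]; field_simp
  set g : ℂ → ℝ := fun ζ => v ζ - h ζ + ε * ‖ζ - c‖ ^ 2
  have hg : ContinuousOn g (closedBall c ρ) := (hv.sub hh).add (by fun_prop)
  obtain ⟨ζ₀, hζ₀, hmax⟩ :=
    (isCompact_closedBall c ρ).exists_isMaxOn ⟨ζ₁, ball_subset_closedBall hζ₁⟩ hg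
  have hin : ζ₀ ∈ ball c ρ := by
    by_contra hnot
    have hs : ζ₀ ∈ sphere c ρ :=
      le_antisymm (mem_closedBall.1 hζ₀) (not_lt.1 (mt mem_ball.2 hnot))
    have h1 : g ζ₁ ≤ g ζ₀ := hmax (ball_subset_closedBall hζ₁)
    have h2 := hle ζ₀ hs
    rw [mem_sphere_iff_norm] at hs
    simp only [g, hs, hερ] at h1
    have : 0 ≤ ε * ‖ζ₁ - c‖ ^ 2 := by positivity
    linarith
  have hT := (hharm ζ₀ hin).1.taylor_two_isLittleO
  set L := fderiv ℝ h ζ₀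
  set Q := fderiv ℝ (fderiv ℝ h) ζ₀
  obtain ⟨β, hβ⟩ := exists_quadratic_eq_re_add_normSq Q (1 : ℂ)
  have hlap : Q 1 1 + Q Complex.I Complex.I = 0 := by
    have := (hharm ζ₀ hin).2.self_of_nhds
    rw [InnerProductSpace.laplacian_eq_iteratedFDeriv_complexPlane] at this
    simpa [iteratedFDeriv_two_apply] using this
  simp only [smul_eq_mul, mul_one, hlap, zero_div, zero_mul, add_zero] at hβ
  have hL : ∀ τ : ℂ, L τ = ((L 1 - L Complex.I * Complex.I : ℂ) * τ).re := by
    intro τ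
    have : L τ = τ.re * L 1 + τ.im * L Complex.I := by
      rw [← smul_eq_mul, ← smul_eq_mul, ← map_smul, ← map_smul, ← map_add]
      simp
    rw [this]
    simp
    ring
  refine ⟨ζ₀, hin, (L 1 - L Complex.I * Complex.I : ℂ) - 2 * ε * (starRingEnd ℂ (ζ₀ - c)), β,
    ε / 2, by positivity, ?_⟩
  have hnear : ∀ᶠ τ in 𝓝 (0 : ℂ), ζ₀ + τ ∈ closedBall c ρ := by
    have h1 : Tendsto (fun τ : ℂ => ζ₀ + τ) (𝓝 0) (𝓝 ζ₀) := by
      have : Continuous fun τ : ℂ => ζ₀ + τ := by fun_prop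
      simpa using this.tendsto 0
    exact (h1.eventually (isOpen_ball.mem_nhds hin)).mono fun _ h => ball_subset_closedBall h
  filter_upwards [hnear, isLittleO_iff.1 hT (half_pos hε)] with τ h1 h2
  have h3 : g (ζ₀ + τ) ≤ g ζ₀ := hmax h1
  rw [Real.norm_eq_abs, Real.norm_eq_abs, abs_of_nonneg (sq_nonneg ‖τ‖), hβ, hL] at h2
  have h4 : ‖ζ₀ + τ - c‖ ^ 2 = ‖ζ₀ - c‖ ^ 2 + (2 * starRingEnd ℂ (ζ₀ - c) * τ).re + ‖τ‖ ^ 2 := by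
    simp only [Complex.sq_norm, Complex.normSq_apply]
    simp
    ring
  have h5 : (((L 1 - L Complex.I * Complex.I : ℂ) - 2 * ε * (starRingEnd ℂ (ζ₀ - c))) * τ +
      β * τ ^ 2).re = ((L 1 - L Complex.I * Complex.I : ℂ) * τ).re + (β * τ ^ 2).re
      - ε * (2 * starRingEnd ℂ (ζ₀ - c) * τ).re := by
    rw [← Complex.re_ofReal_mul, ← Complex.add_re, ← Complex.sub_re]
    congr 1
    ring
  simp only [g, h4] at h3
  rw [h5]
  nlinarith [(abs_le.1 h2).2]

/-! ### Upper bounds near points with a negative Levi direction -/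

/-- If a complex tangent direction of `L₀` is strictly negative for the Levi form of `B₀`, then
nearby forms also have strictly negative complex tangent directions. -/
theorem exists_tangent_levi_neg_of_near {E : Type*} [NormedAddCommGroup E] [NormedSpace ℂ E]
    [NormedSpace ℝ E] [IsScalarTower ℝ ℂ E] {L₀ : E →L[ℝ] ℝ} {B₀ : E →L[ℝ] E →L[ℝ] ℝ} {X : E}
    (hL₀ : L₀ ≠ 0) (hX : L₀ X = 0) (hIX : L₀ (Complex.I • X) = 0)
    (hneg : B₀ X X + B₀ (Complex.I • X) (Complex.I • X) < 0) :
    ∃ ε > 0, ∀ (L : E →L[ℝ] ℝ) (B : E →L[ℝ] E →L[ℝ] ℝ) (η : ℝ),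
      ‖L - L₀‖ < ε → ‖B - B₀‖ < ε → |η| < ε → ∃ Y : E, L Y = 0 ∧ L (Complex.I • Y) = 0 ∧
        B Y Y + B (Complex.I • Y) (Complex.I • Y) + η * ‖Y‖ ^ 2 < 0 := by
  obtain ⟨ν, hν⟩ : ∃ ν, L₀ ν ≠ 0 := by
    by_contra! h
    exact hL₀ (ContinuousLinearMap.ext h)
  -- `d L` is the complex-linear functional with real part `L`; its kernel consists of the complex
  -- tangent directions. Below, `y L` projects `X` to that kernel along `ν` and depends continuously
  -- on `L` near `L₀`.
  set d : (E →L[ℝ] ℝ) → E → ℂ := fun L Y => L Y - L (Complex.I • Y) * Complex.I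
  have hdre : ∀ L Y, (d L Y).re = L Y := fun L Y => by simp [d]
  have hdim : ∀ L Y, (d L Y).im = -L (Complex.I • Y) := fun L Y => by simp [d]
  have hdsub : ∀ L Y Z, d L (Y - Z) = d L Y - d L Z := fun L Y Z => by
    simp [d, smul_sub]; ring
  have hdsmul : ∀ L (c : ℂ) Y, d L (c • Y) = c * d L Y := fun L c Y => by
    have h1 : L (c • Y) = c.re * L Y + c.im * L (Complex.I • Y) := by
      rw [complex_smul_eq_re_smul_add_im_smul]; simp
    have h2 : L (Complex.I • c • Y) = c.re * L (Complex.I • Y) - c.im * L Y := by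
      rw [smul_smul, complex_smul_eq_re_smul_add_im_smul]; simp; ring
    apply Complex.ext <;> simp [d, h1, h2]
    ring
  set y : (E →L[ℝ] ℝ) → E := fun L => X - (d L X / d L ν) • ν
  have hdν : d L₀ ν ≠ 0 := fun h => hν (by rw [← hdre, h, Complex.zero_re])
  have hdX : d L₀ X = 0 := by simp [d, hX, hIX]
  have hcd : ∀ Y, Continuous fun L => d L Y := fun Y => by fun_prop
  have hy : ContinuousAt y L₀ :=
    continuousAt_const.sub
      (((hcd X).continuousAt.div (hcd ν).continuousAt hdν).smul continuousAt_const)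
  have hy0 : y L₀ = X := by simp [y, hdX]
  set Φ : (E →L[ℝ] ℝ) × (E →L[ℝ] E →L[ℝ] ℝ) × ℝ → ℝ := fun q =>
    q.2.1 (y q.1) (y q.1) + q.2.1 (Complex.I • y q.1) (Complex.I • y q.1) + q.2.2 * ‖y q.1‖ ^ 2
  have hΦ : ContinuousAt Φ (L₀, B₀, 0) := by
    have h1 : ContinuousAt (fun q : (E →L[ℝ] ℝ) × (E →L[ℝ] E →L[ℝ] ℝ) × ℝ => y q.1)
        (L₀, B₀, 0) := ContinuousAt.comp (f := Prod.fst) (g := y) hy continuousAt_fst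
    have h2 : ContinuousAt (fun q : (E →L[ℝ] ℝ) × (E →L[ℝ] E →L[ℝ] ℝ) × ℝ => q.2.1)
        (L₀, B₀, 0) := by fun_prop
    have h3 : ContinuousAt (fun q : (E →L[ℝ] ℝ) × (E →L[ℝ] E →L[ℝ] ℝ) × ℝ => q.2.2)
        (L₀, B₀, 0) := by fun_prop
    have h4 := h1.const_smul Complex.I
    exact (((h2.clm_apply h1).clm_apply h1).add ((h2.clm_apply h4).clm_apply h4)).add
      (h3.mul (h1.norm.pow 2))
  have hΦ0 : Φ (L₀, B₀, 0) < 0 := by simpa [Φ, hy0] using hneg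
  have hnu : ∀ᶠ q in 𝓝 ((L₀, B₀, 0) : (E →L[ℝ] ℝ) × (E →L[ℝ] E →L[ℝ] ℝ) × ℝ), d q.1 ν ≠ 0 :=
    ((hcd ν).comp continuous_fst).continuousAt.eventually_ne hdν
  obtain ⟨ε, hε, h⟩ := (Metric.eventually_nhds_iff
    (α := (E →L[ℝ] ℝ) × (E →L[ℝ] E →L[ℝ] ℝ) × ℝ)).1 ((hΦ.eventually_lt_const hΦ0).and hnu)
  refine ⟨ε, hε, fun L B η hL hB hη => ?_⟩
  obtain ⟨h1, h2⟩ := h (y := (L, B, η)) (by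
    rw [Prod.dist_eq, Prod.dist_eq]
    exact max_lt (by rwa [dist_eq_norm])
      (max_lt ((dist_eq_norm B B₀).trans_lt hB) (by simpa using hη)))
  have hz : d L (y L) = 0 := by
    simp only [y, hdsub, hdsmul]
    rw [div_mul_cancel₀ _ h2, sub_self]
  refine ⟨y L, by rw [← hdre, hz, Complex.zero_re], ?_, h1⟩
  rw [← neg_eq_zero, ← hdim, hz, Complex.zero_im]

open Asymptotics in
-- Since `d` has no linear term, the error `(l * d ζ) ^ 2` in `exp x - 1 ≤ x + x ^ 2` is of fourth
-- order. It and the Taylor error each cost `c / 4`, leaving `c / 2` whatever the size of `l`.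
theorem eventually_mul_exp_sub_one_le {d : ℂ → ℝ} {β : ℂ} {c k l : ℝ} (hc : 0 < c) (hk : 0 < k)
    (hl : 0 < l)
    (hd : (fun ζ => d ζ - ((β * ζ ^ 2).re - c * ‖ζ‖ ^ 2)) =o[𝓝 0] fun ζ => ‖ζ‖ ^ 2) :
    ∀ᶠ ζ in 𝓝 (0 : ℂ), k * (Real.exp (l * d ζ) - 1) ≤
      ((k * l * β : ℂ) * ζ ^ 2).re - k * l * c / 2 * ‖ζ‖ ^ 2 := by
  set C := ‖β‖ + c + 1
  have hC : 0 < C := by positivity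
  have hs : ∀ ε > 0, ∀ᶠ ζ in 𝓝 (0 : ℂ), ‖ζ‖ ^ 2 < ε := by
    intro ε hε
    have : Continuous fun ζ : ℂ => ‖ζ‖ ^ 2 := by fun_prop
    exact this.continuousAt.eventually_lt_const (by simpa using hε)
  filter_upwards [isLittleO_iff.1 hd (show 0 < c / 4 by positivity), isLittleO_iff.1 hd one_pos,
    hs (1 / (l * C)) (by positivity), hs (c / (4 * (l * C ^ 2))) (by positivity)]
    with ζ h1 h2 h3 h4
  set s := ‖ζ‖ ^ 2 with hs'
  have hs0 : 0 ≤ s := by positivity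
  rw [Real.norm_eq_abs, Real.norm_eq_abs, abs_of_nonneg hs0] at h1 h2
  have hre : |(β * ζ ^ 2).re| ≤ ‖β‖ * s := by
    refine (Complex.abs_re_le_norm _).trans ?_
    rw [norm_mul, norm_pow]
  have hdC : |d ζ| ≤ C * s := by
    have h5 := abs_le.1 h2
    have h6 := abs_le.1 hre
    have : 0 ≤ c * s := by positivity
    rw [abs_le]
    constructor <;> simp only [C] <;> nlinarith
  rw [lt_div_iff₀ (by positivity)] at h3 h4
  have hx : |l * d ζ| ≤ 1 := by
    rw [abs_mul, abs_of_pos hl]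
    nlinarith
  have hexp := (abs_le.1 (Real.abs_exp_sub_one_sub_id_le hx)).2
  have hd2 : d ζ ^ 2 ≤ (C * s) ^ 2 := by
    rw [← sq_abs]
    gcongr
  have h7 : l * d ζ ^ 2 ≤ c / 4 * s := by
    calc l * d ζ ^ 2 ≤ l * (C * s) ^ 2 := by gcongr
      _ = (s * (4 * (l * C ^ 2))) / 4 * s := by ring
      _ ≤ c / 4 * s := by gcongr
  have h8 : ((k * l * β : ℂ) * ζ ^ 2).re = k * l * (β * ζ ^ 2).re := by
    rw [mul_assoc, ← Complex.ofReal_mul, Complex.re_ofReal_mul]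
  rw [h8]
  have h9 := (abs_le.1 h1).2
  have h10 : Real.exp (l * d ζ) - 1 ≤ l * ((β * ζ ^ 2).re - c / 2 * s) := by
    have : l * (d ζ + l * d ζ ^ 2) ≤ l * ((β * ζ ^ 2).re - c / 2 * s) := by
      gcongr
      linarith
    nlinarith
  calc k * (Real.exp (l * d ζ) - 1) ≤ k * (l * ((β * ζ ^ 2).re - c / 2 * s)) := by gcongr
    _ = _ := by ring

open Asymptotics in
/-- A plurisubharmonic function is not touched from above by an increasing exponential of a
function whose Levi form is strictly negative in some complex tangent direction. -/
theorem PlurisubharmonicOn.not_touch_exp {n : ℕ} {u : EuclideanSpace ℂ (Fin n) → EReal}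
    {Ω : Set (EuclideanSpace ℂ (Fin n))} (hu : PlurisubharmonicOn u Ω)
    {p z₀ : EuclideanSpace ℂ (Fin n)}
    (hΩ : Ω ∈ 𝓝 p) {r : EuclideanSpace ℂ (Fin n) → ℝ} (hr : ContDiffAt ℝ 2 r p)
    {κ l s α : ℝ} (hl : 0 < l) {Y : EuclideanSpace ℂ (Fin n)}
    (hY : ∀ ζ : ℂ, fderiv ℝ r p (ζ • Y) + 2 * κ * (inner ℂ (p - z₀) (ζ • Y)).re = 0)
    (hlevi : fderiv ℝ (fderiv ℝ r) p Y Y +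
      fderiv ℝ (fderiv ℝ r) p (Complex.I • Y) (Complex.I • Y) + 4 * κ * ‖Y‖ ^ 2 < 0)
    (hα : u p = α)
    (hle : ∀ᶠ z in 𝓝 p, u z ≤ ((α + (Real.exp (l * (r z + κ * ‖z - z₀‖ ^ 2 + s)) -
      Real.exp (l * (r p + κ * ‖p - z₀‖ ^ 2 + s))) : ℝ) : EReal)) : False := by
  obtain ⟨β, hβ⟩ := exists_quadratic_eq_re_add_normSq (fderiv ℝ (fderiv ℝ r) p) Y
  set c := -(fderiv ℝ (fderiv ℝ r) p Y Y +
      fderiv ℝ (fderiv ℝ r) p (Complex.I • Y) (Complex.I • Y) + 4 * κ * ‖Y‖ ^ 2) / 4 with hcdef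
  have hc : 0 < c := by simp only [c]; linarith
  set k := Real.exp (l * (r p + κ * ‖p - z₀‖ ^ 2 + s))
  have hk : 0 < k := Real.exp_pos _
  set d : ℂ → ℝ := fun ζ =>
    (r (p + ζ • Y) + κ * ‖p + ζ • Y - z₀‖ ^ 2) - (r p + κ * ‖p - z₀‖ ^ 2)
  have hcont : Tendsto (fun ζ : ℂ => p + ζ • Y) (𝓝 0) (𝓝 p) := by
    have : Continuous fun ζ : ℂ => p + ζ • Y := by fun_prop
    simpa using this.tendsto 0
  have hcont0 : Tendsto (fun ζ : ℂ => ζ • Y) (𝓝 0) (𝓝 0) := by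
    have : Continuous fun ζ : ℂ => ζ • Y := by fun_prop
    simpa using this.tendsto 0
  have hd : (fun ζ => d ζ - ((β * ζ ^ 2).re - c * ‖ζ‖ ^ 2)) =o[𝓝 0] fun ζ => ‖ζ‖ ^ 2 := by
    have h1 := hr.taylor_two_isLittleO.comp_tendsto hcont0
    have h2 : (fun ζ : ℂ => ‖ζ • Y‖ ^ 2) =O[𝓝 0] fun ζ => ‖ζ‖ ^ 2 := by
      have := (isBigO_refl (fun ζ : ℂ => ‖ζ‖ ^ 2) (𝓝 0)).const_mul_left (‖Y‖ ^ 2)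
      refine this.congr_left fun ζ => ?_
      rw [norm_smul]; ring
    refine (h1.trans_isBigO h2).congr_left fun ζ => ?_
    have h3 : ‖p + ζ • Y - z₀‖ ^ 2 = ‖p - z₀‖ ^ 2 + 2 * (inner ℂ (p - z₀) (ζ • Y)).re +
        ‖ζ‖ ^ 2 * ‖Y‖ ^ 2 := by
      rw [add_sub_right_comm, @norm_add_sq ℂ, norm_smul, mul_pow]
      rfl
    have h4 := hY ζ
    simp only [Function.comp, d, h3, hβ, hcdef]
    linear_combination -h4
  refine (hu.2.2 p Y).not_touch (α := α) (c := k * l * c / 2) ?_ 0 (k * l * β) (by positivity)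
    (by simpa using hα) ?_
  · exact hcont.eventually_mem hΩ
  · filter_upwards [eventually_mul_exp_sub_one_le hc hk hl hd, hcont.eventually hle] with ζ h1 h2
    refine h2.trans (EReal.coe_le_coe_iff.2 ?_)
    have h3 : Real.exp (l * (r (p + ζ • Y) + κ * ‖p + ζ • Y - z₀‖ ^ 2 + s)) =
        k * Real.exp (l * d ζ) := by
      rw [← Real.exp_add]
      congr 1
      simp only [d]
      ring
    rw [h3, zero_mul, zero_add]
    linarith

/-- Near a boundary point where the Levi form of a defining function is strictly negative in some
complex tangent direction, plurisubharmonic functions are bounded above. -/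
theorem PlurisubharmonicOn.exists_eventually_le_of_levi_neg {n : ℕ}
    {D U V : Set (EuclideanSpace ℂ (Fin n))} {u : EuclideanSpace ℂ (Fin n) → EReal}
    {r : EuclideanSpace ℂ (Fin n) → ℝ} {a X : EuclideanSpace ℂ (Fin n)}
    (hD : IsOpen D) (hV : IsOpen V) (haV : a ∈ V) (hu : PlurisubharmonicOn u (D ∩ V))
    (hU : IsOpen U) (haU : a ∈ U) (hr : ContDiffOn ℝ 2 r U) (hDU : D ∩ U = {z ∈ U | r z < 0})
    (hdr : fderiv ℝ r a ≠ 0) (hX : fderiv ℝ r a X = 0)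
    (hIX : fderiv ℝ r a (Complex.I • X) = 0)
    (hneg : fderiv ℝ (fderiv ℝ r) a X X +
      fderiv ℝ (fderiv ℝ r) a (Complex.I • X) (Complex.I • X) < 0) :
    ∃ M : ℝ, ∀ᶠ z in 𝓝[D ∩ V] a, u z ≤ (M : EReal) := by
  obtain ⟨ε, hε, hpert⟩ := exists_tangent_levi_neg_of_near hdr hX hIX hneg
  have hra : ContDiffAt ℝ 2 r a := hr.contDiffAt (hU.mem_nhds haU)
  have hc1 : ContinuousAt (fderiv ℝ r) a :=
    (hra.fderiv_right (m := 1) (by norm_num)).continuousAt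
  have hc2 : ContinuousAt (fderiv ℝ (fderiv ℝ r)) a :=
    ((hra.fderiv_right (m := 1) (by norm_num)).fderiv_right (m := 0) (by norm_num)).continuousAt
  have hnear : ∀ᶠ p in 𝓝 a, (p ∈ U ∧ p ∈ V) ∧ dist (fderiv ℝ r p) (fderiv ℝ r a) < ε / 2 ∧
      dist (fderiv ℝ (fderiv ℝ r) p) (fderiv ℝ (fderiv ℝ r) a) < ε :=
    ((hU.eventually_mem haU).and (hV.eventually_mem haV)).and
      ((Metric.tendsto_nhds.1 hc1 _ (half_pos hε)).and
        (hc2.eventually (ball_mem_nhds (fderiv ℝ (fderiv ℝ r) a) hε)))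
  obtain ⟨δ, hδ, hball⟩ := Metric.eventually_nhds_iff_ball.1 hnear
  set R := min (δ / 2) 1
  have hR : 0 < R := lt_min (by positivity) one_pos
  have hR1 : R ≤ 1 := min_le_right _ _
  have hRδ : closedBall a R ⊆ ball a δ :=
    closedBall_subset_ball ((min_le_left _ _).trans_lt (by linarith))
  -- Since `R ≤ 1` gives `‖p - z₀‖ ≤ 2`, the term `κ‖z - z₀‖²` changes the gradient by at most `ε /
  -- 4` and adds `4κ = ε / 4` to the Levi form, within the tolerance of `hpert`.
  set κ := ε / 16
  have hκ : 0 < κ := by positivity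
  have hrc : ContinuousOn r (closedBall a R) :=
    hr.continuousOn.mono fun p hp => (hball p (hRδ hp)).1.1
  have hmemD : ∀ p ∈ closedBall a R, r p < 0 → p ∈ D ∩ V := fun p hp h => by
    have h1 := (hball p (hRδ hp)).1
    have : p ∈ D ∩ U := hDU ▸ ⟨h1.1, h⟩
    exact ⟨this.1, h1.2⟩
  have hbound : ∀ K ⊆ D ∩ V, IsCompact K → ∃ M : ℝ, ∀ z ∈ K, u z ≤ (M : EReal) := by
    intro K hK hKc
    rcases K.eq_empty_or_nonempty with rfl | hne
    · exact ⟨0, by simp⟩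
    obtain ⟨q, hq, hmax⟩ := UpperSemicontinuousOn.exists_isMaxOn hne hKc (hu.1.mono hK)
    exact ⟨(u q).toReal, fun z hz => (hmax hz).trans (EReal.le_coe_toReal (hu.2.1 q (hK hq)))⟩
  -- `M` is fixed before `z₀`. The bound `T` below depends on `z₀`, but only the choice of `l` has
  -- to absorb it.
  obtain ⟨M, hM⟩ := hbound (closedBall a R ∩ r ⁻¹' Iic (-(κ * R ^ 2 / 4)))
    (fun p hp => hmemD p hp.1 (lt_of_le_of_lt hp.2 (by rw [neg_lt_zero]; positivity)))
    ((isCompact_closedBall a R).of_isClosed_subset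
      (hrc.preimage_isClosed_of_isClosed isClosed_closedBall isClosed_Iic) inter_subset_left)
  refine ⟨M + 1, ?_⟩
  filter_upwards [self_mem_nhdsWithin,
    mem_nhdsWithin_of_mem_nhds (ball_mem_nhds a (half_pos hR))] with z₀ hz₀ hz₀R
  have hz₀c : z₀ ∈ closedBall a R := by
    rw [mem_closedBall]; rw [mem_ball] at hz₀R; linarith
  have hrz₀ : r z₀ < 0 := by
    have : z₀ ∈ {z ∈ U | r z < 0} := hDU ▸ ⟨hz₀.1, (hball z₀ (hRδ hz₀c)).1.1⟩
    exact this.2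
  set s := -r z₀
  have hs : 0 < s := neg_pos.2 hrz₀
  set φ : EuclideanSpace ℂ (Fin n) → ℝ := fun z => r z + κ * ‖z - z₀‖ ^ 2
  have hφc : ContinuousOn φ (closedBall a R) := hrc.add (by fun_prop)
  have hrφ : ∀ z, r z ≤ φ z := fun z => by
    have : 0 ≤ κ * ‖z - z₀‖ ^ 2 := by positivity
    simp only [φ]; linarith
  set N := closedBall a R ∩ φ ⁻¹' Iic (-(s / 2))
  have hNc : IsCompact N := (isCompact_closedBall a R).of_isClosed_subset
      (hφc.preimage_isClosed_of_isClosed isClosed_closedBall isClosed_Iic) inter_subset_left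
  have hND : N ⊆ D ∩ V := fun p hp => hmemD p hp.1 (by
    have : φ p ≤ -(s / 2) := hp.2
    linarith [hrφ p])
  have hz₀N : z₀ ∈ N := ⟨hz₀c, by simp [φ, s]; linarith⟩
  obtain ⟨T, hT⟩ := hbound N hND hNc
  obtain ⟨l, hl, hlT⟩ : ∃ l > 0, T - M ≤ Real.exp (l * (s / 2)) := by
    refine ⟨(|T - M| + 1) / (s / 2), by positivity, ?_⟩
    rw [div_mul_cancel₀ _ (by positivity)]
    linarith [Real.add_one_le_exp (|T - M| + 1), le_abs_self (T - M)]
  by_contra! hgt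
  set q : EuclideanSpace ℂ (Fin n) → ℝ := fun z => Real.exp (l * (r z + κ * ‖z - z₀‖ ^ 2 + s))
  have hqc : ContinuousOn q N :=
    Real.continuous_exp.comp_continuousOn
      (continuousOn_const.mul ((hφc.mono inter_subset_left).add continuousOn_const))
  have husc : UpperSemicontinuousOn (fun z => u z + ((-q z : ℝ) : EReal)) N := by
    refine (hu.1.mono hND).add' ?_ ?_
    · exact (continuous_coe_real_ereal.comp_continuousOn hqc.neg).upperSemicontinuousOn
    · exact fun x _ => EReal.continuousAt_add (Or.inr (EReal.coe_ne_bot _))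
        (Or.inr (EReal.coe_ne_top _))
  obtain ⟨p, hpN, hmax⟩ := UpperSemicontinuousOn.exists_isMaxOn ⟨z₀, hz₀N⟩ hNc husc
  have hqz₀ : q z₀ = 1 := by simp [q, s]
  have hpM : (M : EReal) < u p + ((-q p : ℝ) : EReal) := by
    refine lt_of_lt_of_le ?_ (hmax hz₀N)
    change _ < u z₀ + ((-q z₀ : ℝ) : EReal)
    rw [hqz₀]
    have : ((M + 1 : ℝ) : EReal) + ((-1 : ℝ) : EReal) < u z₀ + ((-1 : ℝ) : EReal) :=
      EReal.add_lt_add_right_coe hgt _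
    rw [← EReal.coe_add] at this
    simpa using this
  have hup_top : u p ≠ ⊤ := hu.2.1 p (hND hpN)
  have hup_bot : u p ≠ ⊥ := fun h => by simp [h] at hpM
  obtain ⟨α, hα⟩ : ∃ α : ℝ, u p = α := ⟨(u p).toReal, (EReal.coe_toReal hup_top hup_bot).symm⟩
  have hMα : M < α - q p := by
    rw [hα, ← EReal.coe_add, EReal.coe_lt_coe_iff] at hpM
    linarith
  have hqp : 0 < q p := Real.exp_pos _
  -- On the sphere `‖p - z₀‖ ≥ R / 2`, so `φ p < 0` forces `r p` into the range where `M` bounds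
  -- `u`.
  have hpball : p ∈ ball a R := by
    by_contra hnot
    have hpR : R ≤ dist p a := not_lt.1 hnot
    have hd : R / 2 ≤ ‖p - z₀‖ := by
      rw [← dist_eq_norm]
      have := dist_triangle p z₀ a
      rw [mem_ball] at hz₀R
      linarith
    have hrp : r p ≤ -(κ * R ^ 2 / 4) := by
      have h1 : φ p ≤ -(s / 2) := hpN.2
      have h2 : κ * (R / 2) ^ 2 ≤ κ * ‖p - z₀‖ ^ 2 := by gcongr
      simp only [φ] at h1
      linarith
    have := hM p ⟨hpN.1, hrp⟩
    rw [hα, EReal.coe_le_coe_iff] at this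
    linarith
  -- On the level set `φ = -s/2` the exponential is at least `T - M`, so `u - q ≤ M` there.
  have hφp : φ p < -(s / 2) := by
    refine lt_of_le_of_ne hpN.2 fun h => ?_
    have h1 := hT p hpN
    rw [hα, EReal.coe_le_coe_iff] at h1
    have h2 : q p = Real.exp (l * (s / 2)) := by
      have : q p = Real.exp (l * (φ p + s)) := rfl
      rw [this, h]
      congr 1
      ring
    linarith
  have hN : ∀ᶠ z in 𝓝 p, z ∈ N := by
    have h1 : ContinuousAt φ p :=
      hφc.continuousAt (mem_of_superset (isOpen_ball.mem_nhds hpball) ball_subset_closedBall)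
    filter_upwards [isOpen_ball.mem_nhds hpball, h1.eventually_lt_const hφp] with z h2 h3
    exact ⟨ball_subset_closedBall h2, h3.le⟩
  have hrp : ContDiffAt ℝ 2 r p := hr.contDiffAt (hU.mem_nhds (hball p (hRδ hpN.1)).1.1)
  set J : EuclideanSpace ℂ (Fin n) →L[ℝ] ℝ :=
    Complex.reCLM.comp ((innerSL ℂ (p - z₀)).restrictScalars ℝ)
  have hJ : ‖J‖ ≤ ‖p - z₀‖ := by
    refine ContinuousLinearMap.opNorm_le_bound _ (norm_nonneg _) fun y => ?_
    exact (Complex.abs_re_le_norm _).trans (norm_inner_le_norm (𝕜 := ℂ) (p - z₀) y)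
  have hpz : ‖p - z₀‖ ≤ 2 := by
    rw [← dist_eq_norm]
    have h1 := mem_closedBall.1 hpN.1
    have h2 := mem_closedBall.1 hz₀c
    linarith [dist_triangle_right p z₀ a]
  obtain ⟨Y, hY, hIY, hlevi⟩ := hpert (fderiv ℝ r p + (2 * κ) • J) (fderiv ℝ (fderiv ℝ r) p)
    (4 * κ) (by
      have h1 := (hball p (hRδ hpN.1)).2.1
      rw [dist_eq_norm] at h1
      have h2 : ‖(2 * κ) • J‖ ≤ ε / 4 := by
        rw [norm_smul, Real.norm_eq_abs, abs_of_pos (by positivity)]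
        calc 2 * κ * ‖J‖ ≤ 2 * κ * 2 := by gcongr; exact hJ.trans hpz
          _ = ε / 4 := by simp only [κ]; ring
      rw [add_sub_right_comm]
      linarith [norm_add_le (fderiv ℝ r p - fderiv ℝ r a) ((2 * κ) • J)])
    ((dist_eq_norm (fderiv ℝ (fderiv ℝ r) p) _).symm.trans_lt
      (hball p (hRδ hpN.1)).2.2)
    (by rw [abs_of_pos (by positivity)]; simp only [κ]; linarith)
  refine hu.not_touch_exp (p := p) (z₀ := z₀) (κ := κ) (l := l) (s := s) (α := α) (Y := Y)
    ((hD.inter hV).mem_nhds (hND hpN)) hrp hl ?_ hlevi hα ?_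
  · intro ζ
    have : (fderiv ℝ r p + (2 * κ) • J) (ζ • Y) = 0 := by
      rw [complex_smul_eq_re_smul_add_im_smul, map_add, map_smul, map_smul, hY, hIY]
      simp
    exact this
  · filter_upwards [hN] with z hz
    have h1 : u z + ((-q z : ℝ) : EReal) ≤ u p + ((-q p : ℝ) : EReal) := hmax hz
    have h2 : u z + ((-q z : ℝ) : EReal) + (q z : EReal) ≤
      u p + ((-q p : ℝ) : EReal) + (q z : EReal) := by gcongr
    rw [add_assoc, ← EReal.coe_add, hα, ← EReal.coe_add, ← EReal.coe_add] at h2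
    simp only [neg_add_cancel, EReal.coe_zero, add_zero] at h2
    refine h2.trans (EReal.coe_le_coe_iff.2 ?_)
    linarith

/-! ### From the boundary distance to a negative Levi form -/

theorem ball_infDist_frontier_subset {E : Type*} [NormedAddCommGroup E] [NormedSpace ℝ E]
    {D : Set E} (hD : IsOpen D) {z : E} (hz : z ∈ D) : ball z (infDist z (frontier D)) ⊆ D := by
  rcases (ball z (infDist z (frontier D))).eq_empty_or_nonempty with h | h
  · simp [h]
  have hzb : z ∈ ball z (infDist z (frontier D)) := by
    rw [nonempty_ball] at h
    exact mem_ball_self h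
  refine (convex_ball z _).isPreconnected.subset_of_closure_inter_subset hD ⟨z, hzb, hz⟩ ?_
  rintro x ⟨hx, hxb⟩
  by_contra hxD
  have hxf : x ∈ frontier D := by
    rw [hD.frontier_eq]
    exact ⟨hx, hxD⟩
  have := infDist_le_dist_of_mem (x := z) hxf
  rw [mem_ball'] at hxb
  linarith

theorem infDist_frontier_pos {E : Type*} [PseudoMetricSpace E] {D : Set E} (hD : IsOpen D)
    (hne : (frontier D).Nonempty) {z : E} (hz : z ∈ D) : 0 < infDist z (frontier D) := by
  rw [← isClosed_frontier.notMem_iff_infDist_pos hne, hD.frontier_eq]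
  exact fun h => h.2 hz

open Asymptotics in
-- The left side is the 2-jet of the exponential. Using a polynomial makes the disc through the
-- boundary point exactly quadratic, as `ContDiffAt.parabola_conditions` requires.
theorem norm_taylor_two_exp_le (s₁ s₂ : ℂ) {ε : ℝ} (hε : 0 < ε) :
    ∀ᶠ τ in 𝓝 (0 : ℂ), ‖1 + s₁ * τ + (s₁ ^ 2 / 2 + s₂) * τ ^ 2‖ ≤
      ‖Complex.exp (s₁ * τ + s₂ * τ ^ 2)‖ + ε * ‖τ‖ ^ 2 := by
  set s : ℂ → ℂ := fun τ => s₁ * τ + s₂ * τ ^ 2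
  have hs0 : Tendsto s (𝓝 0) (𝓝 0) := by
    have : Continuous s := by fun_prop
    simpa [s] using this.tendsto 0
  have hsO : s =O[𝓝 0] fun τ : ℂ => τ := by
    have h1 : (fun τ : ℂ => s₁ + s₂ * τ) =O[𝓝 0] fun _ => (1 : ℂ) := by
      have : Continuous fun τ : ℂ => s₁ + s₂ * τ := by fun_prop
      exact (this.tendsto 0).isBigO_one ℂ
    refine ((h1.mul (isBigO_refl (fun τ : ℂ => τ) (𝓝 0))).congr_left fun τ => ?_).congr_right
      fun τ => one_mul τ
    simp only [s]
    ring
  have h1 := ((Complex.exp_sub_sum_range_succ_isLittleO_pow 2).comp_tendsto hs0).trans_isBigO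
    (hsO.pow 2)
  have h2 : (fun τ : ℂ => τ ^ 3 * (s₁ * s₂) + τ ^ 4 * (s₂ ^ 2 / 2)) =o[𝓝 0]
      fun τ : ℂ => τ ^ 2 := by
    have h3 : (fun τ : ℂ => τ ^ 3) =o[𝓝 0] fun τ : ℂ => τ ^ 2 := isLittleO_pow_pow (by norm_num)
    have h4 : (fun τ : ℂ => τ ^ 4) =o[𝓝 0] fun τ : ℂ => τ ^ 2 := isLittleO_pow_pow (by norm_num)
    have h5 := h3.const_mul_left (s₁ * s₂)
    have h6 := h4.const_mul_left (s₂ ^ 2 / 2)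
    exact (h5.add h6).congr_left fun t => by ring
  filter_upwards [isLittleO_iff.1 (h1.add h2) hε] with τ hτ
  have h3 : (1 + s₁ * τ + (s₁ ^ 2 / 2 + s₂) * τ ^ 2 : ℂ) = Complex.exp (s τ) -
      ((Complex.exp (s τ) - ∑ i ∈ Finset.range 3, s τ ^ i / (i.factorial : ℂ)) +
        (τ ^ 3 * (s₁ * s₂) + τ ^ 4 * (s₂ ^ 2 / 2))) := by
    simp [Finset.sum_range_succ, s, Nat.factorial]
    ring
  rw [h3]
  refine (norm_sub_le _ _).trans ?_
  rw [norm_pow] at hτ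
  exact add_le_add le_rfl hτ

/-- If `-log` of the boundary distance is touched from above along a complex line by a strictly
superharmonic quadratic polynomial, then `D` has a boundary point at which every defining function
has a strictly negative Levi form in some complex tangent direction. -/
theorem exists_levi_neg_of_touch {E : Type*} [NormedAddCommGroup E] [NormedSpace ℂ E]
    [NormedSpace ℝ E] [IsScalarTower ℝ ℂ E] [ProperSpace E] {D : Set E} (hD : IsOpen D)
    (hne : (frontier D).Nonempty) {p w : E} (hp : p ∈ D) {A B : ℂ} {c : ℝ} (hc : 0 < c)
    (hle : ∀ᶠ τ in 𝓝 (0 : ℂ), -Real.log (infDist (p + τ • w) (frontier D)) ≤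
      -Real.log (infDist p (frontier D)) + (A * τ + B * τ ^ 2).re - c * ‖τ‖ ^ 2) :
    ∃ b ∈ frontier D, ∀ (U : Set E) (r : E → ℝ), IsOpen U → b ∈ U → ContDiffOn ℝ 2 r U →
      fderiv ℝ r b ≠ 0 → D ∩ U = {z ∈ U | r z < 0} → ∃ X : E, fderiv ℝ r b X = 0 ∧
        fderiv ℝ r b (Complex.I • X) = 0 ∧ fderiv ℝ (fderiv ℝ r) b X X +
          fderiv ℝ (fderiv ℝ r) b (Complex.I • X) (Complex.I • X) < 0 := by
  obtain ⟨b, hb, hbd⟩ := isClosed_frontier.exists_infDist_eq_dist hne p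
  refine ⟨b, hb, fun U r hU hbU hr hdr hDU => ?_⟩
  set δ : E → ℝ := fun z => infDist z (frontier D)
  have hδp : 0 < δ p := infDist_frontier_pos hD hne hp
  set y := b - p
  have hy : ‖y‖ = δ p := by simp only [y, δ, hbd, dist_eq_norm']
  have hcont : Continuous fun τ : ℂ => p + τ • w := by fun_prop
  have hpD : ∀ᶠ τ in 𝓝 (0 : ℂ), p + τ • w ∈ D :=
    hcont.continuousAt.eventually_mem (hD.mem_nhds (by simpa using hp))
  set P : ℂ → ℂ := fun τ => 1 + -A * τ + ((-A) ^ 2 / 2 + -B) * τ ^ 2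
  set σ := c / 4 * δ p
  have hσ : 0 < σ := by positivity
  have hmargin : ∀ᶠ τ in 𝓝 (0 : ℂ), ‖P τ‖ * ‖y‖ + σ * ‖τ‖ ^ 2 ≤ δ (p + τ • w) := by
    have hhalf : ∀ᶠ τ in 𝓝 (0 : ℂ), 1 / 2 < ‖Complex.exp (-A * τ + -B * τ ^ 2)‖ := by
      have : Continuous fun τ : ℂ => ‖Complex.exp (-A * τ + -B * τ ^ 2)‖ := by fun_prop
      exact this.continuousAt.eventually_const_lt (by norm_num)
    filter_upwards [hle, hpD, hhalf, norm_taylor_two_exp_le (-A) (-B)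
      (show 0 < c / 4 by positivity)] with τ h1 h2 h3 h4
    have hpos : 0 < δ (p + τ • w) := infDist_frontier_pos hD hne h2
    set e := ‖Complex.exp (-A * τ + -B * τ ^ 2)‖ with he
    have h5 : δ p * e * Real.exp (c * ‖τ‖ ^ 2) ≤ δ (p + τ • w) := by
      have h6 : Real.log (δ p) + (-A * τ + -B * τ ^ 2).re + c * ‖τ‖ ^ 2 ≤
          Real.log (δ (p + τ • w)) := by
        have : (-A * τ + -B * τ ^ 2).re = -(A * τ + B * τ ^ 2).re := by
          rw [← Complex.neg_re]; congr 1; ring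
        rw [this]
        linarith
      have := Real.exp_le_exp.2 h6
      rwa [Real.exp_add, Real.exp_add, Real.exp_log hδp, Real.exp_log hpos,
        ← Complex.norm_exp] at this
    have h7 := Real.add_one_le_exp (c * ‖τ‖ ^ 2)
    set q := ‖τ‖ ^ 2
    have hq : 0 ≤ c * q := by positivity
    have h8 : e + c * q / 2 ≤ e * Real.exp (c * q) := by nlinarith
    rw [hy]
    calc ‖P τ‖ * δ p + σ * q ≤ (e + c / 4 * q) * δ p + σ * q := by gcongr
      _ = δ p * (e + c * q / 2) := by simp only [σ]; ring
      _ ≤ δ p * (e * Real.exp (c * q)) := by gcongr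
      _ = δ p * e * Real.exp (c * q) := by ring
      _ ≤ _ := h5
  have hrb : 0 ≤ r b := by
    by_contra! h
    have : b ∈ D ∩ U := hDU ▸ ⟨hbU, h⟩
    rw [hD.frontier_eq] at hb
    exact hb.2 this.1
  obtain ⟨η, hη⟩ : ∃ η, 0 < fderiv ℝ r b η := by
    by_contra! h
    refine hdr (ContinuousLinearMap.ext fun v => le_antisymm (h v) ?_)
    simpa using h (-v)
  set X := w - A • y
  set V := ((-A) ^ 2 / 2 + -B) • y
  -- The push `ς • η` increases `r` to first order. It stays strictly below the margin `σ`, so the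
  -- curve remains in the open ball of radius `δ (p + τ • w)`.
  set ς := σ / (2 * (‖η‖ + 1))
  have hς : 0 < ς := by positivity
  have hςη : ‖ς • η‖ < σ := by
    rw [norm_smul, Real.norm_eq_abs, abs_of_pos hς]
    have h1 : ς * (2 * (‖η‖ + 1)) = σ := by simp only [ς]; field_simp
    nlinarith [norm_nonneg η]
  set d : ℂ → E := fun τ => τ • X + τ ^ 2 • V + ‖τ‖ ^ 2 • ς • η
  have hd : Continuous d := by fun_prop
  have hbdU : ∀ᶠ τ in 𝓝 (0 : ℂ), b + d τ ∈ U :=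
    (continuous_const.add hd).continuousAt.eventually_mem (hU.mem_nhds (by simpa [d] using hbU))
  have hcurve : ∀ᶠ τ in 𝓝 (0 : ℂ), r (b + d τ) ≤ r b := by
    filter_upwards [hmargin, hpD, hbdU] with τ h1 h2 h3
    rcases eq_or_ne τ 0 with rfl | hτ
    · simp [d]
    have h4 : b + d τ = (p + τ • w) + (P τ • y + ‖τ‖ ^ 2 • ς • η) := by
      simp only [d, P, X, V, y]
      module
    have h5 : b + d τ ∈ D := by
      refine ball_infDist_frontier_subset hD h2 ?_
      rw [h4, mem_ball, dist_eq_norm, add_sub_cancel_left]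
      refine (norm_add_le _ _).trans_lt (lt_of_lt_of_le ?_ h1)
      rw [norm_smul, norm_smul (‖τ‖ ^ 2), norm_pow, norm_norm, mul_comm σ]
      have : 0 < ‖τ‖ ^ 2 := by positivity
      gcongr
    have h6 : b + d τ ∈ {z ∈ U | r z < 0} := hDU ▸ ⟨h5, h3⟩
    exact h6.2.le.trans hrb
  have hrb2 : ContDiffAt ℝ 2 r b := hr.contDiffAt (hU.mem_nhds hbU)
  have hreal : Tendsto (fun t : ℝ => (t : ℂ)) (𝓝 0) (𝓝 0) := by
    simpa using Complex.continuous_ofReal.tendsto 0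
  have himag : Tendsto (fun t : ℝ => (t : ℂ) * Complex.I) (𝓝 0) (𝓝 0) := by
    have : Continuous fun t : ℝ => (t : ℂ) * Complex.I := by fun_prop
    simpa using this.tendsto 0
  have hsmul : ∀ (t : ℝ) (v : E), (t : ℂ) • v = t • v := fun t v => algebraMap_smul ℂ t v
  -- Restrict to `τ = t` and `τ = i t`. The holomorphic term `τ ^ 2 • V` changes sign between them
  -- and cancels in the sum, while `‖τ‖ ^ 2 • ς • η` does not and makes the Levi form strictly
  -- negative.
  obtain ⟨h1, h2⟩ := hrb2.parabola_conditions (X := X) (W := V + ς • η) (by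
    filter_upwards [hreal.eventually hcurve] with t ht
    convert! ht using 3
    simp only [d]
    rw [Complex.norm_real, Real.norm_eq_abs, sq_abs, ← Complex.ofReal_pow, hsmul, hsmul, smul_add,
      add_assoc])
  obtain ⟨h3, h4⟩ := hrb2.parabola_conditions (X := Complex.I • X) (W := -V + ς • η) (by
    filter_upwards [himag.eventually hcurve] with t ht
    convert! ht using 3
    simp only [d]
    rw [norm_mul, Complex.norm_I, mul_one, Complex.norm_real, Real.norm_eq_abs, sq_abs, mul_pow,
      Complex.I_sq, mul_smul, mul_smul, ← Complex.ofReal_pow, hsmul, hsmul, smul_add, add_assoc,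
      neg_one_smul])
  refine ⟨X, h1, h3, ?_⟩
  simp only [map_add, map_neg, map_smul, smul_eq_mul] at h2 h4
  have : 0 < ς * fderiv ℝ r b η := by positivity
  linarith

/-! ### Conclusion -/

theorem proposition2 {n : ℕ} (D : Set (EuclideanSpace ℂ (Fin n)))
    (hD_open : IsOpen D) (hD_conn : IsConnected D) (hD_smooth : IsC2Smooth D)
    (h : ∀ a ∈ frontier D, ∃ (U : Set (EuclideanSpace ℂ (Fin n)))
      (u : EuclideanSpace ℂ (Fin n) → EReal),
      IsOpen U ∧ a ∈ U ∧ PlurisubharmonicOn u (D ∩ U) ∧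
      limsup u (𝓝[D ∩ U] a) = ⊤) :
    IsPseudoconvex D := by
  have hcont : Continuous fun z : EuclideanSpace ℂ (Fin n) =>
      -ENNReal.log (infEDist z (frontier D)) :=
    continuous_neg.comp (ENNReal.continuous_log.comp continuous_infEDist)
  -- The empty frontier is treated apart: there `infEDist` is `⊤`, whereas the real-valued `infDist`
  -- used afterwards would be `0`.
  rcases (frontier D).eq_empty_or_nonempty with hemp | hne
  · have hbot : (fun z : EuclideanSpace ℂ (Fin n) => -ENNReal.log (infEDist z (frontier D))) =
        fun _ => ⊥ := by
      ext z; simp [hemp]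
    unfold IsPseudoconvex
    rw [hbot]
    refine ⟨upperSemicontinuousOn_const, by simp, fun z w => ⟨upperSemicontinuousOn_const, by simp,
      ?_⟩⟩
    intros
    exact bot_le
  have hval : ∀ z ∈ D, -ENNReal.log (infEDist z (frontier D)) =
      ((-Real.log (infDist z (frontier D)) : ℝ) : EReal) := by
    intro z hz
    rw [← ENNReal.ofReal_toReal (infEDist_ne_top hne)]
    rw [show (infEDist z (frontier D)).toReal = infDist z (frontier D) from rfl,
      ENNReal.log_ofReal_of_pos (infDist_frontier_pos hD_open hne hz), EReal.coe_neg]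
  have htop : ∀ z ∈ D, -ENNReal.log (infEDist z (frontier D)) ≠ ⊤ := fun z hz => by
    rw [hval z hz]; exact EReal.coe_ne_top _
  refine ⟨hcont.upperSemicontinuous.upperSemicontinuousOn _, htop, fun z w => ⟨?_, ?_, ?_⟩⟩
  · have : Continuous fun ζ : ℂ => z + ζ • w := by fun_prop
    exact (hcont.comp this).upperSemicontinuous.upperSemicontinuousOn _
  · exact fun ζ hζ => htop _ hζ
  intro c ρ H hρ hsub hHc hH hsphere ζ₁ hζ₁
  by_contra! hlt
  have hline : Continuous fun ζ : ℂ => z + ζ • w := by fun_prop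
  have hvc : ContinuousOn (fun ζ : ℂ => -Real.log (infDist (z + ζ • w) (frontier D)))
      (closedBall c ρ) := by
    refine (ContinuousOn.log ?_ fun ζ hζ =>
      (infDist_frontier_pos hD_open hne (hsub hζ)).ne').neg
    exact ((continuous_infDist_pt _).comp hline).continuousOn
  obtain ⟨ζ₀, hζ₀, A, B, κ, hκ, htouch⟩ := exists_touch_of_not_le_harmonic hvc hHc hH
    (fun ζ hζ => by
      have : -ENNReal.log (infEDist (z + ζ • w) (frontier D)) ≤ (H ζ : EReal) := hsphere ζ hζ
      rwa [hval _ (hsub (sphere_subset_closedBall hζ)), EReal.coe_le_coe_iff] at this) hζ₁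
    (by rwa [hval _ (hsub (ball_subset_closedBall hζ₁)), EReal.coe_lt_coe_iff] at hlt)
  obtain ⟨b, hb, hlevi⟩ := exists_levi_neg_of_touch hD_open hne (p := z + ζ₀ • w) (w := w)
    (A := A) (B := B) (hsub (ball_subset_closedBall hζ₀)) hκ (by
      filter_upwards [htouch] with τ hτ
      rwa [add_smul, ← add_assoc] at hτ)
  obtain ⟨U, r, hU, hbU, hr, hdr, hDU⟩ := hD_smooth b hb
  obtain ⟨X, hX, hIX, hneg⟩ := hlevi U r hU hbU hr (hdr b hbU) hDU
  obtain ⟨V, u, hV, hbV, hu, hlim⟩ := h b hb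
  obtain ⟨M, hM⟩ := hu.exists_eventually_le_of_levi_neg hD_open hV hbV hU hbU hr hDU (hdr b hbU)
    hX hIX hneg
  have := limsup_le_of_le (h := hM)
  rw [hlim, top_le_iff] at this
  exact EReal.coe_ne_top _ this
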